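/- Let $\kappa$ be a regular uncountable cardinal and let $E^\kappa_\omega=\{\delta<\kappa : \mathrm{cf}(\delta)=\omega\}$. A ladder system over a stationary set $S\subseteq\kappa$ is a sequence $\vec L=\langle A_\delta : \delta\in S\rangle$ such that each $A_\delta$ is a cofinal subset of $\delta$; it is $\omega$-bounded if every $A_\delta$ has order type at most $\omega$. The space $X_{\vec L}$ has underlying set $(\kappa\times\{0\})\cup(S\times\{1\})$; all points of $\kappa\times\{0\}$ are isolated, and the sets $(A\times\{0\})\cup\{(\delta,1)\}$, with $A$ an end segment of $A_\delta$, form a neighbourhood base at $(\delta,1)$ for each $\delta\in S$. A topological space $X$ is countably metacompact if for every decreasing sequence $\langle D_n : n<\omega\rangle$ of closed subsets of $X$ with empty intersection there is a decreasing sequence $\langle U_n : n<\omega\rangle$ of open subsets of $X$ with empty intersection such that $D_n\subseteq U_n$ for all $n<\omega$. Theorem. Let $\lambda$ be an infinite cardinal such that $\kappa:=2^{2^{2^{\lambda}}}$ is a finite successor of $\lambda$, that is, $\kappa=\lambda^{+n}$ for some $n<\omega$. Then $\kappa$ is regular and uncountable, $E^\kappa_\omega$ is stationary in $\kappa$, and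 there is an $\omega$-bounded ladder system $\vec L$ over $E^\kappa_\omega$ for which $X_{\vec L}$ is a regular, Hausdorff, first countable space that is not countably metacompact. In particular, if $2^{2^{2^{\aleph_0}}}<\aleph_\omega$, then the conclusion holds for $\kappa:=2^{2^{2^{\aleph_0}}}$. -/

import Mathlib

open Cardinal Ordinal Set

universe u

/-- `E^κ_μ`: the set of all ordinals `δ < κ` of cofinality `μ`. -/
def cofSet (κ μ : Cardinal.{u}) : Set (Iio κ.ord) :=
  {δ | (δ : Ordinal.{u}).cof = μ}

/-- A ladder system over a stationary subset `S` of a regular uncountable cardinal `κ`: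
a sequence assigning to every `δ ∈ S` a cofinal subset of `δ`. -/
structure LadderSystem (κ : Cardinal.{u}) (S : Set (Iio κ.ord)) where
  /-- `κ` is regular. -/
  regular : κ.IsRegular
  /-- `κ` is uncountable. -/
  uncountable : ℵ₀ < κ
  /-- `S` is stationary in `κ`. -/
  stationary : IsStationary S
  /-- The set `A δ`, for `δ ∈ S`. -/
  ladder : S → Set (Iio κ.ord)
  /-- `A δ` consists of ordinals below `δ`. -/
  lt_of_mem : ∀ (δ : S), ∀ α ∈ ladder δ, α < δ
  /-- `A δ` is cofinal in `δ`. -/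
  cofinal : ∀ (δ : S), ∀ β < (δ : Iio κ.ord), ∃ α ∈ ladder δ, β ≤ α

/-- `A` is an end segment of `B`. (An end segment of a nonempty set is nonempty.) -/
def IsEndSegment {α : Type*} [LinearOrder α] (A B : Set α) : Prop :=
  A ⊆ B ∧ (B.Nonempty → A.Nonempty) ∧ ∀ a ∈ A, ∀ b ∈ B, a ≤ b → b ∈ A

theorem IsEndSegment.refl {α : Type*} [LinearOrder α] (B : Set α) : IsEndSegment B B :=
  ⟨subset_rfl, id, fun _ _ _ hb _ => hb⟩

theorem IsEndSegment.inter {α : Type*} [LinearOrder α] {A A' B : Set α}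
    (h : IsEndSegment A B) (h' : IsEndSegment A' B) : IsEndSegment (A ∩ A') B := by
  refine ⟨fun x hx => h.1 hx.1, fun hB => ?_,
    fun a ha b hb hab => ⟨h.2.2 a ha.1 b hb hab, h'.2.2 a ha.2 b hb hab⟩⟩
  obtain ⟨a, ha⟩ := h.2.1 hB
  obtain ⟨a', ha'⟩ := h'.2.1 hB
  rcases le_total a a' with hle | hle
  · exact ⟨a', h.2.2 a ha a' (h'.1 ha') hle, ha'⟩
  · exact ⟨a, ha, h'.2.2 a' ha' a (h.1 ha) hle⟩

namespace LadderSystem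

variable {κ : Cardinal.{u}} {S : Set (Iio κ.ord)}

/-- The ladder system is `ξ`-bounded: every `A δ` has order type at most `ξ`. -/
def IsBounded (L : LadderSystem κ S) (ξ : Ordinal.{u}) : Prop :=
  ∀ δ : S, Ordinal.type (α := L.ladder δ) (· < ·) ≤ Ordinal.lift.{u + 1} ξ

/-- The underlying set `(κ × {0}) ∪ (S × {1})` of the space `X_L`:
`Sum.inl α` is the point `(α, 0)` and `Sum.inr δ` is the point `(δ, 1)`. -/
def Space (_L : LadderSystem κ S) : Type (u + 1) :=
  Iio κ.ord ⊕ S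

/-- The point `(α, 0)` of `X_L`. -/
def base (L : LadderSystem κ S) (α : Iio κ.ord) : L.Space := Sum.inl α

/-- The point `(δ, 1)` of `X_L`. -/
def top (L : LadderSystem κ S) (δ : S) : L.Space := Sum.inr δ

/-- The topology of `X_L`: all points `(α, 0)` are isolated, and the sets
`(A × {0}) ∪ {(δ, 1)}`, with `A` an end segment of `A δ`, form a neighbourhood base of `(δ, 1)`. -/
instance (L : LadderSystem κ S) : TopologicalSpace L.Space where
  IsOpen U := ∀ δ : S, L.top δ ∈ U →
    ∃ A : Set (Iio κ.ord), IsEndSegment A (L.ladder δ) ∧ ∀ α ∈ A, L.base α ∈ U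
  isOpen_univ δ _ := ⟨L.ladder δ, IsEndSegment.refl _, fun _ _ => mem_univ _⟩
  isOpen_inter U V hU hV δ hδ := by
    obtain ⟨A, hA, hAU⟩ := hU δ hδ.1
    obtain ⟨B, hB, hBV⟩ := hV δ hδ.2
    exact ⟨A ∩ B, hA.inter hB, fun α hα => ⟨hAU α hα.1, hBV α hα.2⟩⟩
  isOpen_sUnion s hs δ := by
    rintro ⟨U, hUs, hU⟩
    obtain ⟨A, hA, hAU⟩ := hs U hUs δ hU
    exact ⟨A, hA, fun α hα => ⟨U, hUs, hAU α hα⟩⟩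

end LadderSystem

/-- A space is countably metacompact iff every decreasing sequence of closed sets with empty
intersection expands to a decreasing sequence of open sets with empty intersection. -/
def CountablyMetacompact (X : Type*) [TopologicalSpace X] : Prop :=
  ∀ D : ℕ → Set X, Antitone D → (∀ n, IsClosed (D n)) → ⋂ n, D n = ∅ →
    ∃ U : ℕ → Set X, Antitone U ∧ (∀ n, IsOpen (U n)) ∧ ⋂ n, U n = ∅ ∧ ∀ n, D n ⊆ U n

/-! Put χ = 2^(2^λ), so that κ = ν⁺ = 2^χ for some ν. It suffices to find ladders c_δ and colours
g(δ) < ω such that every f : κ → ω is constantly g(δ) on c_δ for some δ: the closed sets of tops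
with g(δ) ≥ n then have no open expansion with empty intersection
(`not_countablyMetacompact_space`).

Suppose there are none. By Engelking–Karłowicz (`exists_independent_family`) there are independent
functions r_ε (ε < χ) from κ to Baire space and r'_ζ (ζ < ν) from κ to ν. Let r'_ζ(δ) name a
countable sequence below δ, and let r_ε, evaluated at an ordinal code(δ), name a subsequence of it
and a colour. Each pair (ζ, ε) is then a candidate, refuted by some f_{ζε}. Since 2^χ = κ, the tuple
(f_{ζε}(α))_ε is coded by an ordinal below κ. Take a continuous ω₁-sequence b whose limits are
closed under these codes, and a ζ for which r'_ζ names an enumeration of {b_j : j < i} at every b_i,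
0 < i < ω₁.

For each ε, f_{ζε} is constant on a ladder of some b_i (`exists_monochromatic_ladder`), so some real
describes this ladder and its colour. By completeness (`exists_evading_subset_range`) a single i has
the property that, for all but continuum many y, r_ε(y) is such a description for some ε. As code(δ)
avoids all small exceptional sets of this kind, some candidate succeeds at b_i, against f_{ζε}. -/

/-! ### Independent families and evasion -/

theorem nonempty_prod_embedding {Θ X : Type*} [Nontrivial Θ] (hX : Nonempty ((Θ → X) ↪ X)) :
    Nonempty (X × X ↪ X) := by
  classical
  obtain ⟨F⟩ := hX
  obtain ⟨t₀, t₁, ht⟩ := exists_pair_ne Θ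
  refine ⟨⟨fun q => F fun t => if t = t₀ then q.1 else q.2, ?_⟩⟩
  rintro ⟨a, b⟩ ⟨c, d⟩ h
  have h := F.injective h
  have h0 := congrFun h t₀
  have h1 := congrFun h t₁
  simp_all [ht.symm]

theorem nonempty_set_embedding {Θ X : Type*} [Nontrivial X] (hX : Nonempty ((Θ → X) ↪ X)) :
    Nonempty (Set Θ ↪ X) := by
  classical
  obtain ⟨F⟩ := hX
  obtain ⟨x₀, x₁, hx⟩ := exists_pair_ne X
  refine ⟨⟨fun A => F fun t => if t ∈ A then x₀ else x₁, ?_⟩⟩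
  intro A B h
  ext t
  have h := congrFun (F.injective h) t
  by_cases hA : t ∈ A <;> by_cases hB : t ∈ B <;> simp_all

theorem nonempty_embedding_of_fun {Θ X : Type*} [Nontrivial X] (hX : Nonempty ((Θ → X) ↪ X)) :
    Nonempty (Θ ↪ X) := by
  obtain ⟨F⟩ := nonempty_set_embedding hX
  exact ⟨⟨fun t => F {t}, fun s t h => by simpa using h⟩⟩

theorem nonempty_fun_embedding_of_surjective {Θ J X : Type*} (hX : Nonempty ((Θ → X) ↪ X))
    {g : Θ → J} (hg : Function.Surjective g) : Nonempty ((J → X) ↪ X) := by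
  obtain ⟨F⟩ := hX
  exact ⟨⟨fun f => F (f ∘ g), F.injective.comp hg.injective_comp_right⟩⟩

/-- **Engelking–Karłowicz**: if `X` has as many elements as there are functions `Θ → X`, then there
is a family of `X` many functions `Y → X` extending every `Θ`-sized partial function. -/
theorem exists_independent_family {X Θ Y : Type*} [Infinite Θ] [Nontrivial X]
    (hX : Nonempty ((Θ → X) ↪ X)) (hY : Nonempty (Y ↪ Set X)) :
    ∃ r : X → Y → X, ∀ p : Θ → Y, Function.Injective p → ∀ v : Θ → X,
      ∃ ε, ∀ t, r ε (p t) = v t := by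
  classical
  obtain ⟨e⟩ := hY
  obtain ⟨pairX, hpair⟩ := nonempty_prod_embedding hX
  obtain ⟨setX, hset⟩ := nonempty_set_embedding hX
  obtain ⟨F⟩ := hX
  obtain ⟨x₀⟩ : Nonempty X := inferInstance
  -- A code consists of sample points in X and a list of pairs (trace, value); `R` gives y the value
  -- listed for the trace of `e y` on the sample.
  let G : (Θ → X) × (Θ → Set Θ × X) → X := fun q =>
    pairX (F q.1, F fun t => pairX (setX (q.2 t).1, (q.2 t).2))
  have hG : Function.Injective G := by
    rintro ⟨a, b⟩ ⟨c, d⟩ h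
    have h := hpair h
    simp only [Prod.mk.injEq, EmbeddingLike.apply_eq_iff_eq] at h
    refine Prod.ext h.1 (funext fun t => ?_)
    have h := hpair (congrFun h.2 t)
    simp only [Prod.mk.injEq] at h
    exact Prod.ext (hset h.1) h.2
  have : Nonempty ((Θ → X) × (Θ → Set Θ × X)) := ⟨(fun _ => x₀, fun _ => (∅, x₀))⟩
  let R : (Θ → X) × (Θ → Set Θ × X) → Y → X := fun q y =>
    if h : ∃ t, (q.2 t).1 = {i | q.1 i ∈ e y} then (q.2 h.choose).2 else x₀
  refine ⟨fun ε => R (Function.invFun G ε), fun p hp v => ?_⟩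
  have hd : ∀ q : Θ × Θ, ∃ x, q.1 ≠ q.2 → ¬ (x ∈ e (p q.1) ↔ x ∈ e (p q.2)) := by
    rintro ⟨s, t⟩
    by_cases hst : s = t
    · exact ⟨x₀, fun h => absurd hst h⟩
    · by_contra! hcon
      exact hst (hp (e.injective (Set.ext fun x => (hcon x).2)))
  choose d hd using hd
  -- One sample point per pair separates all the sets `e (p t)`, and there are only Θ many pairs.
  obtain ⟨π⟩ : Nonempty (Θ ≃ Θ × Θ) := by
    have : #Θ = #(Θ × Θ) := by simp [Cardinal.mul_eq_self (Cardinal.aleph0_le_mk Θ)]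
    exact Cardinal.eq.1 this
  let x : Θ → X := fun i => d (π i)
  let tr : Y → Set Θ := fun y => {i | x i ∈ e y}
  have htr : ∀ s t, tr (p s) = tr (p t) → s = t := by
    intro s t h
    by_contra hst
    have h2 : π.symm (s, t) ∈ tr (p s) ↔ π.symm (s, t) ∈ tr (p t) := by rw [h]
    simp only [tr, x, mem_ofPred_eq, Equiv.apply_symm_apply] at h2
    exact hd (s, t) hst h2
  refine ⟨G (x, fun t => (tr (p t), v t)), fun t => ?_⟩
  simp only [Function.leftInverse_invFun hG _, R]
  have h : ∃ s, tr (p s) = tr (p t) := ⟨t, rfl⟩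
  have h' := htr _ _ h.choose_spec
  rw [dif_pos h]
  exact congrArg v h'

/-- Sets none of which is covered by `ι` many points have an injective system of representatives. -/
theorem exists_injective_mem {ι Y : Type*} [Nonempty Y] (T : ι → Set Y)
    (hT : ∀ i, ∀ q : ι → Y, ¬ T i ⊆ range q) :
    ∃ y : ι → Y, Function.Injective y ∧ ∀ i, y i ∈ T i := by
  classical
  obtain ⟨r, hr⟩ := exists_wellFoundedLT ι
  have key : ∀ i (y : ∀ j, j < i → Y), ∃ z ∈ T i, ∀ j (h : j < i), y j h ≠ z := by
    intro i y
    obtain ⟨w, hw⟩ : (T i).Nonempty := by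
      by_contra h
      rw [not_nonempty_iff_eq_empty] at h
      exact hT i (fun _ => Classical.arbitrary Y) (by simp [h])
    obtain ⟨z, hz, hz'⟩ := not_subset.1 (hT i fun j => if h : j < i then y j h else w)
    exact ⟨z, hz, fun j h he => hz' ⟨j, by simp [h, he]⟩⟩
  choose F hF hF' using key
  let y : ι → Y := (wellFounded_lt (α := ι)).fix F
  have hy : ∀ i, y i = F i fun j _ => y j := fun i => WellFounded.fix_eq _ _ _
  refine ⟨y, ?_, fun i => by rw [hy]; exact hF _ _⟩
  have hlt : ∀ i j, i < j → y i ≠ y j := by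
    intro i j h
    rw [hy j]
    exact hF' j (fun j _ => y j) i h
  intro i j h
  rcases lt_trichotomy i j with h' | h' | h'
  · exact absurd h (hlt _ _ h')
  · exact h'
  · exact absurd h.symm (hlt _ _ h')

/-- The ideal of sets of indices on which an independent family can be evaded by many points is
complete: the relation `Q` cannot be evaded at every `i`. -/
theorem exists_evading_subset_range {E Θ I Y : Type*} [Nonempty Y] {r : E → Y → Θ}
    (hr : ∀ p : I × Θ → Y, Function.Injective p → ∀ v : I × Θ → Θ, ∃ ε, ∀ t, r ε (p t) = v t)
    {Q : I → E → Θ → Prop} (hQ : ∀ ε, ∃ i t, Q i ε t) :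
    ∃ i, ∃ q : I × Θ → Y, {y | ∀ ε, ¬ Q i ε (r ε y)} ⊆ range q := by
  by_contra! hcon
  -- If every evading set is large, it provides a separate point for each value t; independence
  -- gives one ε taking value t at the point of (i, t), for all i and t at once.
  obtain ⟨y, hy, hyT⟩ := exists_injective_mem (fun k : I × Θ => {y | ∀ ε, ¬ Q k.1 ε (r ε y)})
    fun k => hcon k.1
  obtain ⟨ε, hε⟩ := hr y hy Prod.snd
  obtain ⟨i, t, hit⟩ := hQ ε
  apply hyT (i, t) ε
  rwa [hε]

/-! ### Continuous sequences of length ω₁ -/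

section Sequences

variable {Y : Type*} [LinearOrder Y] {W : Type*} [LinearOrder W] [WellFoundedLT W]

/-- A continuous increasing sequence of length `W` that is closed under `K`. -/
theorem exists_continuous_sequence [WellFoundedLT Y] [Nonempty Y] (hW : ∀ i : W, (Iio i).Countable)
    (hY : ∀ q : ℕ → Y, ∃ y, ∀ n, q n < y) (K : Y → Y) (hK : ∀ y, y < K y) :
    ∃ b : W → Y, StrictMono b ∧ (∀ i j, i < j → K (b i) ≤ b j) ∧
      ∀ i, (∀ j < i, ∃ k < i, j < k) → IsLUB (b '' Iio i) (b i) := by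
  classical
  -- Taking the least bound at each stage makes the sequence continuous at limits.
  have key : ∀ i (b : ∀ j : W, j < i → Y), ∃ y, (∀ j h, K (b j h) ≤ y) ∧
      ∀ z, (∀ j h, K (b j h) ≤ z) → y ≤ z := by
    intro i b
    have hne : {y | ∀ j h, K (b j h) ≤ y}.Nonempty := by
      by_cases hi : (Iio i).Nonempty
      · obtain ⟨e, he⟩ := (hW i).exists_eq_range hi
        have hlt : ∀ n, e n < i := fun n => by
          have : e n ∈ Iio i := he ▸ mem_range_self n
          exact this
        obtain ⟨y, hy⟩ := hY fun n => K (b (e n) (hlt n))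
        refine ⟨y, fun j h => ?_⟩
        have : j ∈ range e := he ▸ h
        obtain ⟨n, rfl⟩ := this
        exact (hy n).le
      · exact ⟨Classical.arbitrary Y, fun j h => absurd ⟨j, h⟩ hi⟩
    exact ⟨wellFounded_lt.min _ hne, wellFounded_lt.min_mem _ hne,
      fun z hz => wellFounded_lt.min_le (s := {y | ∀ j h, K (b j h) ≤ y}) hz⟩
  choose F hF hF' using key
  let b : W → Y := (wellFounded_lt (α := W)).fix F
  have hb : ∀ i, b i = F i fun j _ => b j := fun i => WellFounded.fix_eq _ _ _
  have hKb : ∀ i j, i < j → K (b i) ≤ b j := by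
    intro i j h
    rw [hb j]
    exact hF j (fun j _ => b j) i h
  have hmono : StrictMono b := fun i j h => (hK _).trans_le (hKb i j h)
  refine ⟨b, hmono, hKb, fun i hi => ⟨?_, fun z hz => ?_⟩⟩
  · rintro _ ⟨j, hj, rfl⟩
    exact (hmono hj).le
  · rw [hb i]
    refine hF' i _ z fun j h => ?_
    obtain ⟨k, hk, hjk⟩ := hi j h
    exact (hKb j k hjk).trans (hz ⟨k, hk, rfl⟩)

/-- A countable colouring of an uncountable continuous sequence is constant on a ladder of one of
its limit points. -/
theorem exists_monochromatic_ladder [Uncountable W] (hW : ∀ i : W, (Iio i).Countable) {b : W → Y}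
    (hb : StrictMono b) (hlim : ∀ i, (∀ j < i, ∃ k < i, j < k) → IsLUB (b '' Iio i) (b i))
    (f : Y → ℕ) :
    ∃ i n, ∃ s : ℕ → W, (∀ k, s k < i) ∧ (∀ j < i, ∃ k < i, j < k) ∧ (∀ k, f (b (s k)) = n) ∧
      StrictMono (b ∘ s) ∧ IsLUB (range (b ∘ s)) (b i) := by
  have hIic : ∀ i : W, (Iic i).Countable := fun i => by
    rw [← Iio_insert]
    exact (hW i).insert i
  -- An uncountable colour class is unbounded, so it contains an increasing ω-sequence; `i` is the
  -- least index above it.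
  obtain ⟨n, hn⟩ : ∃ n, ¬ {i | f (b i) = n}.Countable := by
    by_contra! hcon
    refine not_countable_univ (α := W) ((countable_iUnion hcon).mono fun i _ => ?_)
    exact mem_iUnion.2 ⟨f (b i), rfl⟩
  have hunb : ∀ i, ∃ j, i < j ∧ f (b j) = n := by
    intro i
    by_contra! hcon
    exact hn ((hIic i).mono fun j hj => not_lt.1 fun h => hcon j h hj)
  choose g hg hgn using hunb
  obtain ⟨i₀⟩ : Nonempty W := inferInstance
  let s : ℕ → W := fun k => g^[k + 1] i₀
  have hs : StrictMono s := strictMono_nat_of_lt_succ fun k => by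
    simp only [s, Function.iterate_succ_apply' g (k + 1)]
    exact hg _
  have hne : {i | ∀ k, s k < i}.Nonempty := by
    by_contra hcon
    refine not_countable_univ (α := W)
      ((countable_iUnion fun k => hIic (s k)).mono fun i _ => ?_)
    by_contra h
    simp only [mem_iUnion, mem_Iic, not_exists, not_le] at h
    exact hcon ⟨i, h⟩
  let i := wellFounded_lt.min _ hne
  have hi : ∀ k, s k < i := wellFounded_lt.min_mem _ hne
  have hcof : ∀ j < i, ∃ k, j ≤ s k := by
    intro j hj
    by_contra! hcon
    exact (wellFounded_lt.min_le (s := {i | ∀ k, s k < i}) hcon).not_gt hj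
  have hli : ∀ j < i, ∃ k < i, j < k := by
    intro j hj
    obtain ⟨k, hk⟩ := hcof j hj
    exact ⟨s (k + 1), hi _, hk.trans_lt (hs k.lt_succ_self)⟩
  refine ⟨i, n, s, hi, hli, fun k => ?_, hb.comp hs, ?_, fun z hz => ?_⟩
  · simp only [s, Function.iterate_succ_apply']
    exact hgn _
  · rintro _ ⟨k, rfl⟩
    exact (hb (hi k)).le
  · refine (hlim i hli).2 ?_
    rintro _ ⟨j, hj, rfl⟩
    obtain ⟨k, hk⟩ := hcof j hj
    exact (hb.monotone hk).trans (hz ⟨k, rfl⟩)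

end Sequences

/-! ### The guessing theorem -/

/-- The sequence `c` increases to `δ`. -/
def IsLadderSeq {Y : Type*} [LinearOrder Y] (δ : Y) (c : ℕ → Y) : Prop :=
  StrictMono c ∧ IsLUB (range c) δ

theorem IsLadderSeq.lt {Y : Type*} [LinearOrder Y] {δ : Y} {c : ℕ → Y} (h : IsLadderSeq δ c)
    (k : ℕ) : c k < δ :=
  (h.1 k.lt_succ_self).trans_le (h.2.1 ⟨k + 1, rfl⟩)

theorem IsLadderSeq.exists_lt {Y : Type*} [LinearOrder Y] {δ β : Y} {c : ℕ → Y}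
    (h : IsLadderSeq δ c) (hβ : β < δ) : ∃ k, β < c k := by
  by_contra! hcon
  refine (h.2.2 ?_).not_gt hβ
  rintro _ ⟨k, rfl⟩
  exact hcon k

/-- In the application Y, X, N, W have sizes κ = ν⁺ = 2^χ, χ, ν and ℵ₁. -/
theorem exists_guessing_ladders {Y X N W : Type*} [LinearOrder Y] [WellFoundedLT Y] [Nonempty Y]
    [LinearOrder W] [WellFoundedLT W] [Uncountable W] (hW : ∀ i : W, (Iio i).Countable)
    (hWΘ : Nonempty ((ℕ → ℕ) ≃ W × (ℕ → ℕ))) [Nontrivial X] [Nontrivial N]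
    (hX : Nonempty (((ℕ → ℕ) → X) ↪ X)) (hN : Nonempty (((ℕ → ℕ) → N) ↪ N))
    (hYX : Nonempty (Y ↪ Set X)) (hXY : Nonempty ((X → ℕ) ↪ Y)) (hYN : Nonempty (Y ↪ Set N))
    (hIio : ∀ δ : Y, Nonempty (Iio δ ↪ N)) (hbdd : ∀ q : N → Y, ∃ y, ∀ x, q x < y) :
    ∃ (c : Y → ℕ → Y) (g : Y → ℕ), (∀ δ, (∃ c, IsLadderSeq δ c) → IsLadderSeq δ (c δ)) ∧
      ∀ f : Y → ℕ, ∃ δ, (∃ c, IsLadderSeq δ c) ∧ ∀ k, f (c δ k) = g δ := by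
  classical
  obtain ⟨eΘ⟩ := hWΘ
  obtain ⟨eN⟩ := nonempty_embedding_of_fun hN
  obtain ⟨pN⟩ := nonempty_prod_embedding hN
  have hNω : Nonempty ((ℕ → N) ↪ N) :=
    nonempty_fun_embedding_of_surjective hN (g := fun t : ℕ → ℕ => t 0) fun n => ⟨fun _ => n, rfl⟩
  have hNW : Nonempty ((W → N) ↪ N) :=
    nonempty_fun_embedding_of_surjective hN (g := fun t => (eΘ t).1) fun i =>
      ⟨eΘ.symm (i, 0), by simp⟩
  -- the functions indexed by `X` colouring `Y` by elements of `ℕ → ℕ`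
  obtain ⟨eX⟩ := nonempty_embedding_of_fun hX
  obtain ⟨r₀, hr₀⟩ := exists_independent_family hX hYX
  obtain ⟨col, hcol⟩ : ∃ col : X → (ℕ → ℕ), Function.Surjective col :=
    ⟨_, Function.invFun_surjective eX.injective⟩
  let r : X → Y → (ℕ → ℕ) := fun ε y => col (r₀ ε y)
  have hr : ∀ p : W × (ℕ → ℕ) → Y, Function.Injective p → ∀ v : W × (ℕ → ℕ) → (ℕ → ℕ),
      ∃ ε, ∀ t, r ε (p t) = v t := by
    intro p hp v
    obtain ⟨ε, hε⟩ := hr₀ (p ∘ eΘ) (hp.comp eΘ.injective)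
      fun t => Function.surjInv hcol (v (eΘ t))
    refine ⟨ε, fun t => ?_⟩
    have := hε (eΘ.symm t)
    simp only [Function.comp_apply, Equiv.apply_symm_apply] at this
    simp only [r, this, Function.surjInv_eq]
  obtain ⟨r', hr'⟩ := exists_independent_family hNW hYN
  -- the sequences below `δ`, listed by `N`
  have ha : ∀ δ : Y, ∃ a : N → ℕ → Y, ∀ w : ℕ → Y, (∀ k, w k < δ) → ∃ x, a x = w := by
    intro δ
    obtain ⟨e⟩ := hIio δ
    obtain ⟨F⟩ := hNω
    by_cases hne : Nonempty (ℕ → Iio δ)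
    · have hinj : Function.Injective fun w : ℕ → Iio δ => F (e ∘ w) :=
        F.injective.comp e.injective.comp_left
      refine ⟨fun x k => Function.invFun (fun w : ℕ → Iio δ => F (e ∘ w)) x k, fun w hw => ?_⟩
      refine ⟨F (e ∘ fun k => ⟨w k, hw k⟩), ?_⟩
      funext k
      exact congrArg Subtype.val (congrFun (Function.leftInverse_invFun hinj fun k => ⟨w k, hw k⟩) k)
    · exact ⟨fun _ _ => δ, fun w hw => absurd ⟨fun k => ⟨w k, hw k⟩⟩ hne⟩
  choose a ha using ha
  obtain ⟨π⟩ := hXY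
  let π' : Y → (X → ℕ) := Function.invFun π
  have hπ : ∀ u, π' (π u) = u := Function.leftInverse_invFun π.injective
  -- the colour `t` describes a ladder of `δ` on which the function coded by `x` has value `t 0`
  let lad : Y → N → (ℕ → ℕ) → ℕ → Y := fun δ ζ t k => a δ (r' ζ δ) (t (k + 1))
  let P : Y → N → N → X → (ℕ → ℕ) → Prop := fun δ ζ x ε t =>
    IsLadderSeq δ (lad δ ζ t) ∧ ∀ k, π' (a δ x (t (k + 1))) ε = t 0
  -- There are ν many pairs (ζ, x), each with at most continuum many exceptional points, so some y
  -- lies above them all.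
  have hcode : ∀ δ, ∃ y, ∀ ζ x,
      (∃ q : W × (ℕ → ℕ) → Y, {y | ∀ ε, ¬ P δ ζ x ε (r ε y)} ⊆ range q) →
      ∃ ε, P δ ζ x ε (r ε y) := by
    intro δ
    let T : N × N → Set Y := fun z => {y | ∀ ε, ¬ P δ z.1 z.2 ε (r ε y)}
    let q : N × N → (ℕ → ℕ) → Y := fun z =>
      if h : ∃ q : W × (ℕ → ℕ) → Y, T z ⊆ range q then h.choose ∘ eΘ
      else fun _ => Classical.arbitrary Y
    let E : (N × N) × (ℕ → ℕ) → N := fun z => pN (pN z.1, eN z.2)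
    have hE : Function.Injective E := by
      rintro ⟨z, s⟩ ⟨z', s'⟩ h
      simpa [E] using h
    obtain ⟨y, hy⟩ := hbdd fun x => (q (Function.invFun E x).1 (Function.invFun E x).2)
    refine ⟨y, fun ζ x h => ?_⟩
    by_contra! hcon
    have hT : y ∈ T (ζ, x) := hcon
    have h' : ∃ q : W × (ℕ → ℕ) → Y, T (ζ, x) ⊆ range q := h
    obtain ⟨w, hw⟩ := h'.choose_spec hT
    have := hy (E ((ζ, x), eΘ.symm w))
    rw [Function.leftInverse_invFun hE] at this
    simp only [q, dif_pos h', Function.comp_apply, Equiv.apply_symm_apply, hw] at this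
    exact lt_irrefl _ this
  choose code hcode using hcode
  by_contra! hcon
  -- the ladders and colours given by `ζ` and `ε`
  have hdef : ∀ δ : Y, ∃ c : ℕ → Y, (∃ c, IsLadderSeq δ c) → IsLadderSeq δ c := by
    intro δ
    by_cases h : ∃ c, IsLadderSeq δ c
    · exact ⟨h.choose, fun _ => h.choose_spec⟩
    · exact ⟨fun _ => δ, fun h' => absurd h' h⟩
  choose c₀ hc₀ using hdef
  let c : N → X → Y → ℕ → Y := fun ζ ε δ =>
    if IsLadderSeq δ (lad δ ζ (r ε (code δ))) then lad δ ζ (r ε (code δ)) else c₀ δ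
  have hc : ∀ ζ ε δ, (∃ c, IsLadderSeq δ c) → IsLadderSeq δ (c ζ ε δ) := by
    intro ζ ε δ h
    by_cases h' : IsLadderSeq δ (lad δ ζ (r ε (code δ)))
    · simpa only [c, if_pos h'] using h'
    · simpa only [c, if_neg h'] using hc₀ δ h
  have hfail := fun ζ ε => hcon (c ζ ε) (fun δ => r ε (code δ) 0) (hc ζ ε)
  choose f hf using hfail
  -- All refuting colours of α, over every ε in X, are packed into a single element of Y.
  let H : N → Y → Y := fun ζ α => π fun ε => f ζ ε α
  have hK : ∀ β, ∃ y, β < y ∧ ∀ ζ, ∀ α ≤ β, H ζ α < y := by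
    intro β
    obtain ⟨γ, hγ⟩ := hbdd fun _ => β
    obtain ⟨e⟩ := hIio γ
    let G : N × Iio γ → N := fun z => pN (z.1, e z.2)
    have hG : Function.Injective G := by
      rintro ⟨z, s⟩ ⟨z', s'⟩ h
      simpa [G] using h
    have hβγ : β < γ := hγ (Classical.arbitrary N)
    have : Nonempty (N × Iio γ) := ⟨(Classical.arbitrary N, ⟨β, hβγ⟩)⟩
    obtain ⟨y, hy⟩ := hbdd fun x =>
      max γ (H (Function.invFun G x).1 (Function.invFun G x).2)
    refine ⟨y, hβγ.trans ((le_max_left _ _).trans_lt (hy (Classical.arbitrary N))),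
      fun ζ α hα => ?_⟩
    have := (le_max_right _ _).trans_lt (hy (G (ζ, ⟨α, hα.trans_lt hβγ⟩)))
    rwa [Function.leftInverse_invFun hG] at this
  choose K hK hKH using hK
  have hbddω : ∀ q : ℕ → Y, ∃ y, ∀ n, q n < y := by
    intro q
    obtain ⟨y, hy⟩ := hbdd fun x => q (Function.invFun eN x 0)
    refine ⟨y, fun n => ?_⟩
    have := hy (eN fun _ => n)
    rwa [Function.leftInverse_invFun eN.injective] at this
  obtain ⟨b, hb, hKb, hlim⟩ := exists_continuous_sequence hW hbddω K hK
  have hclosed : ∀ i, (∀ j < i, ∃ k < i, j < k) → ∀ ζ, ∀ α < b i, H ζ α < b i := by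
    intro i hi ζ α hα
    obtain ⟨_, ⟨j, hj, rfl⟩, hαj, -⟩ := (hlim i hi).exists_between hα
    obtain ⟨k, hk, hjk⟩ := hi j hj
    exact (hKH _ ζ α hαj.le).trans_le ((hKb j k hjk).trans (hb hk).le)
  have henum : ∀ i, ∃ x : N, (Iio i).Nonempty → range (a (b i) x) = b '' Iio i := by
    intro i
    by_cases hi : (Iio i).Nonempty
    · obtain ⟨e, he⟩ := (hW i).exists_eq_range hi
      obtain ⟨x, hx⟩ := ha (b i) (b ∘ e) fun k => hb (by
        have : e k ∈ Iio i := he ▸ mem_range_self k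
        exact this)
      exact ⟨x, fun _ => by rw [hx, he, range_comp]⟩
    · exact ⟨Classical.arbitrary N, fun h => absurd h hi⟩
  choose v hv using henum
  -- Choosing ζ after b is not circular: b was closed under `H ζ` for every ζ.
  obtain ⟨ζ, hζ⟩ := hr' b hb.injective v
  -- codes for the values of `f ζ` on the sequence of `ζ` at `b i`
  have hcodes : ∀ i, ∃ x, (Iio i).Nonempty → (∀ j < i, ∃ k < i, j < k) →
      ∀ k, a (b i) x k = H ζ (a (b i) (v i) k) := by
    intro i
    by_cases hi : (Iio i).Nonempty ∧ ∀ j < i, ∃ k < i, j < k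
    · obtain ⟨x, hx⟩ := ha (b i) (fun k => H ζ (a (b i) (v i) k)) fun k => by
        refine hclosed i hi.2 ζ _ ?_
        have : a (b i) (v i) k ∈ b '' Iio i := hv i hi.1 ▸ mem_range_self k
        obtain ⟨j, hj, h⟩ := this
        rw [← h]
        exact hb hj
      exact ⟨x, fun _ _ k => congrFun hx k⟩
    · exact ⟨Classical.arbitrary N, fun h h' => absurd ⟨h, h'⟩ hi⟩
  choose x hx using hcodes
  let Q : W → X → (ℕ → ℕ) → Prop := fun i ε t =>
    (Iio i).Nonempty ∧ (∀ j < i, ∃ k < i, j < k) ∧ P (b i) ζ (x i) ε t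
  have hQ : ∀ ε, ∃ i t, Q i ε t := by
    intro ε
    obtain ⟨i, n, s, hsi, hi, hfs, hs, hlub⟩ := exists_monochromatic_ladder hW hb hlim (f ζ ε)
    have hne : (Iio i).Nonempty := ⟨s 0, hsi 0⟩
    have hmem : ∀ k, ∃ m, a (b i) (v i) m = b (s k) := fun k => by
      have : b (s k) ∈ range (a (b i) (v i)) := hv i hne ▸ ⟨s k, hsi k, rfl⟩
      exact this
    choose m hm using hmem
    have hlad : lad (b i) ζ (fun k => Nat.casesOn k n m) = b ∘ s := by
      funext k
      simp only [lad, hζ, hm, Function.comp_apply]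
    -- The real has the colour in entry 0 and the positions of the ladder in the enumeration after
    -- it.
    refine ⟨i, fun k => Nat.casesOn k n m, hne, hi, ?_, fun k => ?_⟩
    · rw [hlad]
      exact ⟨hs, hlub⟩
    · simp only [hx i hne hi, hm, H, hπ, hfs]
      rfl
  obtain ⟨i, q, hq⟩ := exists_evading_subset_range hr hQ
  -- At any other index every point evades, but continuum many points cannot cover Y.
  have hi : (Iio i).Nonempty ∧ ∀ j < i, ∃ k < i, j < k := by
    by_contra hi
    have hall : ∀ y, y ∈ range q := fun y => hq fun ε h => hi ⟨h.1, h.2.1⟩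
    obtain ⟨y, hy⟩ := hbdd fun x => q (eΘ (Function.invFun eN x))
    obtain ⟨w, hw⟩ := hall y
    have := hy (eN (eΘ.symm w))
    rw [Function.leftInverse_invFun eN.injective, Equiv.apply_symm_apply, hw] at this
    exact lt_irrefl _ this
  obtain ⟨ε, hε⟩ := hcode (b i) ζ (x i)
    ⟨q, fun y hy => hq fun ε h => hy ε h.2.2⟩
  obtain ⟨k, hk⟩ := hf ζ ε (b i) ⟨_, hε.1⟩
  apply hk
  simp only [c, if_pos hε.1]
  have h := hε.2 k
  rw [hx i hi.1 hi.2, hπ] at h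
  simp only [lad, hζ]
  exact h

/-! ### Cofinality ω and stationarity -/

theorem exists_isLadderSeq_of_cof_eq_aleph0 {κ : Cardinal.{u}} {δ : Iio κ.ord}
    (hδ : (δ : Ordinal.{u}).cof = ℵ₀) : ∃ c, IsLadderSeq δ c := by
  obtain ⟨s, hs, hst⟩ := exists_ord_cof_eq (Iio (δ : Ordinal.{u}))
  rw [cof_Iio, ← lift_cof, hδ, lift_aleph0, ord_aleph0] at hst
  obtain ⟨e⟩ : Nonempty ((· < · : ℕ → ℕ → Prop) ≃r (· < · : s → s → Prop)) := by
    rw [← lift_type_eq.{0, u + 1, 0}, hst]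
    simp
  have hlt : ∀ k, ((e k).1 : Ordinal) < κ.ord := fun k => (e k).1.2.trans δ.2
  refine ⟨fun k => ⟨(e k).1.1, hlt k⟩, fun m n h => ?_, ?_, fun z hz => ?_⟩
  · exact e.map_rel_iff.2 h
  · rintro _ ⟨k, rfl⟩
    exact (e k).1.2.le
  · by_contra! hzδ
    obtain ⟨w, hw, hzw⟩ := hs ⟨z.1, hzδ⟩
    have h1 : ∀ k, ((e k).1 : Ordinal) ≤ z := fun k => hz ⟨k, rfl⟩
    have h2 := h1 (e.symm ⟨w, hw⟩ + 1)
    have h3 : (⟨w, hw⟩ : s) < e (e.symm ⟨w, hw⟩ + 1) := by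
      conv_lhs => rw [← e.apply_symm_apply ⟨w, hw⟩]
      exact e.map_rel_iff.2 (Nat.lt_succ_self _)
    exact absurd (lt_of_lt_of_le h3 (show (e (e.symm ⟨w, hw⟩ + 1)).1 ≤ w from h2.trans hzw))
      (lt_irrefl _)

theorem IsLadderSeq.cof_eq_aleph0 {κ : Cardinal.{u}} {δ : Iio κ.ord} {c : ℕ → Iio κ.ord}
    (h : IsLadderSeq δ c) : (δ : Ordinal.{u}).cof = ℵ₀ := by
  let d : ℕ → Iio (δ : Ordinal.{u}) := fun k => ⟨c k, h.lt k⟩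
  have hd : StrictMono d := fun m n hmn => h.1 hmn
  have hcof : IsCofinal (range d) := by
    intro β
    obtain ⟨k, hk⟩ := h.exists_lt (β := ⟨β.1, lt_trans (mem_Iio.1 β.2) δ.2⟩) β.2
    exact ⟨d k, ⟨k, rfl⟩, hk.le⟩
  have := Order.lift_cof_congr_of_strictMono hd hcof
  rw [cof_Iio, ← lift_cof, Order.cof_eq_aleph0, lift_aleph0, Cardinal.lift_lift] at this
  exact Cardinal.lift_eq_aleph0.1 this.symm

/-- A club contains an increasing ω-sequence, and the supremum of that sequence lies in both the
club and S. -/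
theorem isStationary_of_forall_isLadderSeq {Y : Type*} [LinearOrder Y] [WellFoundedLT Y] [Nonempty Y]
    (hbdd : ∀ q : ℕ → Y, ∃ y, ∀ n, q n < y) {S : Set Y}
    (hS : ∀ δ c, IsLadderSeq δ c → δ ∈ S) : IsStationary S := by
  rintro C hC
  have key : ∀ y, ∃ z ∈ C, y < z := by
    intro y
    obtain ⟨y', hy'⟩ := hbdd fun _ => y
    obtain ⟨z, hz, hyz⟩ := hC.isCofinal y'
    exact ⟨z, hz, (hy' 0).trans_le hyz⟩
  choose g hgC hg using key
  let c : ℕ → Y := fun n => g^[n + 1] (Classical.arbitrary Y)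
  have hc : ∀ n, c (n + 1) = g (c n) := fun n => Function.iterate_succ_apply' g (n + 1) _
  have hcC : ∀ n, c n ∈ C := fun n => by
    simp only [c, Function.iterate_succ_apply']
    exact hgC _
  have hne : (upperBounds (range c)).Nonempty := by
    obtain ⟨y, hy⟩ := hbdd c
    refine ⟨y, ?_⟩
    rintro _ ⟨n, rfl⟩
    exact (hy n).le
  have hlub : IsLUB (range c) (wellFounded_lt.min _ hne) :=
    ⟨wellFounded_lt.min_mem _ hne, fun z hz => wellFounded_lt.min_le hz⟩
  refine ⟨_, hS _ c ⟨strictMono_nat_of_lt_succ fun n => (hc n).symm ▸ hg _, hlub⟩, ?_⟩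
  exact hC.isLUB_mem (range_subset_iff.2 hcC) (range_nonempty c) hlub

theorem type_range_le_omega0 {Y : Type (u + 1)} [LinearOrder Y] [WellFoundedLT Y] {c : ℕ → Y}
    (hc : StrictMono c) : typeLT (range c) ≤ Ordinal.lift.{u + 1} (ω : Ordinal.{u}) := by
  have e : (· < · : ℕ → ℕ → Prop) ≃r (· < · : range c → range c → Prop) :=
    (hc.orderIso).toRelIsoLT
  have := lift_type_eq.{0, u + 1, 0}.2 ⟨e⟩
  simp only [type_nat_lt, lift_omega0, Ordinal.lift_uzero] at this ⊢
  exact this.symm.le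

/-! ### Topology of the ladder space -/

namespace LadderSystem

variable {κ : Cardinal.{u}} {S : Set (Iio κ.ord)} (L : LadderSystem κ S)

/-- `(A × {0}) ∪ {(δ, 1)}` -/
def basic (δ : S) (A : Set (Iio κ.ord)) : Set L.Space := insert (L.top δ) (L.base '' A)

variable {L}

theorem top_mem_basic {δ ε : S} {A : Set (Iio κ.ord)} : L.top ε ∈ L.basic δ A ↔ ε = δ := by
  refine ⟨?_, fun h => Or.inl (congrArg _ h)⟩
  rintro (h | ⟨α, -, h⟩)
  · exact Sum.inr_injective h
  · exact absurd h Sum.inl_ne_inr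

theorem base_mem_basic {δ : S} {α : Iio κ.ord} {A : Set (Iio κ.ord)} :
    L.base α ∈ L.basic δ A ↔ α ∈ A := by
  refine ⟨?_, fun h => Or.inr ⟨α, h, rfl⟩⟩
  rintro (h | ⟨β, hβ, h⟩)
  · exact absurd h Sum.inl_ne_inr
  · rwa [← Sum.inl_injective h]

theorem isOpen_basic {δ : S} {A : Set (Iio κ.ord)} (hA : IsEndSegment A (L.ladder δ)) :
    IsOpen (L.basic δ A) := by
  intro ε hε
  obtain rfl := top_mem_basic.1 hε
  exact ⟨A, hA, fun α hα => base_mem_basic.2 hα⟩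

theorem isOpen_singleton_base (α : Iio κ.ord) : IsOpen {L.base α} := by
  intro ε hε
  exact absurd hε Sum.inr_ne_inl

theorem space_cases (x : L.Space) : (∃ α, x = L.base α) ∨ ∃ δ, x = L.top δ := by
  rcases x with α | δ
  · exact Or.inl ⟨α, rfl⟩
  · exact Or.inr ⟨δ, rfl⟩

theorem isEndSegment_image_Ici {c : ℕ → Iio κ.ord} (hc : StrictMono c) (k : ℕ) :
    IsEndSegment (c '' Ici k) (range c) := by
  refine ⟨image_subset_range _ _, fun _ => nonempty_Ici.image c, ?_⟩
  rintro _ ⟨m, hm, rfl⟩ _ ⟨n, rfl⟩ h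
  exact ⟨n, hm.trans (hc.le_iff_le.1 h), rfl⟩

section

variable {c : S → ℕ → Iio κ.ord} (hc : ∀ δ : S, IsLadderSeq (δ : Iio κ.ord) (c δ))
  (hL : ∀ δ, L.ladder δ = range (c δ))
include hc hL

theorem exists_basic_subset {δ : S} {U : Set L.Space} (hU : IsOpen U) (hδ : L.top δ ∈ U) :
    ∃ k, L.basic δ (c δ '' Ici k) ⊆ U := by
  obtain ⟨A, hA, hAU⟩ := hU δ hδ
  rw [hL] at hA
  obtain ⟨a, ha⟩ := hA.2.1 (range_nonempty _)
  obtain ⟨k, rfl⟩ := hA.1 ha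
  refine ⟨k, ?_⟩
  rintro _ (rfl | ⟨_, ⟨m, hm, rfl⟩, rfl⟩)
  · exact hδ
  · exact hAU _ (hA.2.2 _ ha _ ⟨m, rfl⟩ ((hc δ).1.monotone hm))

theorem isOpen_basic_image_Ici (δ : S) (k : ℕ) : IsOpen (L.basic δ (c δ '' Ici k)) :=
  isOpen_basic (hL δ ▸ isEndSegment_image_Ici (hc δ).1 k)

omit hL in
theorem exists_forall_image_Ici_lt {δ : S} {β : Iio κ.ord} (hβ : β < δ) :
    ∃ k, ∀ α ∈ c δ '' Ici k, β < α := by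
  obtain ⟨k, hk⟩ := (hc δ).exists_lt hβ
  refine ⟨k, ?_⟩
  rintro _ ⟨m, hm, rfl⟩
  exact hk.trans_le ((hc δ).1.monotone hm)

omit hL in
theorem exists_notMem_image_Ici (δ : S) (β : Iio κ.ord) : ∃ k, β ∉ c δ '' Ici k := by
  rcases lt_or_ge β δ with h | h
  · obtain ⟨k, hk⟩ := exists_forall_image_Ici_lt hc h
    exact ⟨k, fun hβ => lt_irrefl _ (hk β hβ)⟩
  · refine ⟨0, ?_⟩
    rintro ⟨m, -, rfl⟩
    exact ((hc δ).lt m).not_ge h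

theorem isClosed_singleton_base (β : Iio κ.ord) : IsClosed {L.base β} := by
  rw [← isOpen_compl_iff]
  intro ε _
  obtain ⟨k, hk⟩ := exists_notMem_image_Ici hc ε β
  refine ⟨_, hL ε ▸ isEndSegment_image_Ici (hc ε).1 k, fun α hα h => hk ?_⟩
  rwa [← Sum.inl_injective (mem_singleton_iff.1 h)]

theorem isClosed_basic (δ : S) (k : ℕ) : IsClosed (L.basic δ (c δ '' Ici k)) := by
  rw [← isOpen_compl_iff]
  intro ε hε
  have hne : ε ≠ δ := fun h => hε (top_mem_basic.2 h)
  suffices h : ∃ m, ∀ α ∈ c ε '' Ici m, α ∉ c δ '' Ici k by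
    obtain ⟨m, hm⟩ := h
    exact ⟨_, hL ε ▸ isEndSegment_image_Ici (hc ε).1 m, fun α hα h => hm α hα (base_mem_basic.1 h)⟩
  rcases lt_or_gt_of_ne hne with h | h
  · obtain ⟨m, hm⟩ := exists_forall_image_Ici_lt hc h
    -- Only the first m points of the ladder of δ can lie at or below ε; a late enough end segment
    -- at ε misses each of them.
    choose n hn using fun j => exists_notMem_image_Ici hc ε (c δ j)
    refine ⟨(Finset.range m).sup n, ?_⟩
    rintro _ hα ⟨j, hj, rfl⟩
    rcases lt_or_ge j m with hjm | hjm
    · exact hn j (image_mono (Ici_subset_Ici.2 (Finset.le_sup (Finset.mem_range.2 hjm))) hα)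
    · obtain ⟨i, -, hi⟩ := hα
      have := hm _ ⟨j, hjm, rfl⟩
      rw [← hi] at this
      exact this.not_gt ((hc ε).lt i)
  · obtain ⟨m, hm⟩ := exists_forall_image_Ici_lt hc h
    refine ⟨m, ?_⟩
    rintro _ hα ⟨j, hj, rfl⟩
    exact (hm _ hα).not_gt ((hc δ).lt j)

theorem regularSpace_space : RegularSpace L.Space := by
  refine .of_exists_mem_nhds_isClosed_subset fun x s hs => ?_
  obtain ⟨U, hUs, hU, hxU⟩ := mem_nhds_iff.1 hs
  rcases space_cases x with ⟨α, rfl⟩ | ⟨δ, rfl⟩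
  · exact ⟨_, (isOpen_singleton_base α).mem_nhds rfl, isClosed_singleton_base hc hL α,
      singleton_subset_iff.2 (hUs hxU)⟩
  · obtain ⟨k, hk⟩ := exists_basic_subset hc hL hU hxU
    exact ⟨_, (isOpen_basic_image_Ici hc hL δ k).mem_nhds (top_mem_basic.2 rfl),
      isClosed_basic hc hL δ k, hk.trans hUs⟩

theorem t2Space_space : T2Space L.Space := by
  refine ⟨fun x y hxy => ?_⟩
  rcases space_cases x with ⟨α, rfl⟩ | ⟨δ, rfl⟩
  · exact ⟨_, _, isOpen_singleton_base α, (isClosed_singleton_base hc hL α).isOpen_compl, rfl,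
      hxy.symm, disjoint_compl_right⟩
  rcases space_cases y with ⟨β, rfl⟩ | ⟨ε, rfl⟩
  · exact ⟨_, _, (isClosed_singleton_base hc hL β).isOpen_compl, isOpen_singleton_base β, hxy,
      rfl, disjoint_compl_left⟩
  · refine ⟨_, _, isOpen_basic_image_Ici hc hL δ 0, (isClosed_basic hc hL δ 0).isOpen_compl,
      top_mem_basic.2 rfl, fun h => hxy ?_, disjoint_compl_right⟩
    rw [top_mem_basic.1 h]

theorem firstCountableTopology_space : FirstCountableTopology L.Space := by
  refine ⟨fun x => ?_⟩
  rcases space_cases x with ⟨α, rfl⟩ | ⟨δ, rfl⟩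
  · rw [(isOpen_singleton_iff_nhds_eq_pure _).1 (isOpen_singleton_base α)]
    infer_instance
  · have hb : (nhds (L.top δ)).HasBasis (fun _ : ℕ => True) fun k => L.basic δ (c δ '' Ici k) := by
      refine ⟨fun s => ⟨fun hs => ?_, ?_⟩⟩
      · obtain ⟨U, hUs, hU, hxU⟩ := mem_nhds_iff.1 hs
        obtain ⟨k, hk⟩ := exists_basic_subset hc hL hU hxU
        exact ⟨k, trivial, hk.trans hUs⟩
      · rintro ⟨k, -, hk⟩
        exact Filter.mem_of_superset
          ((isOpen_basic_image_Ici hc hL δ k).mem_nhds (top_mem_basic.2 rfl)) hk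
    exact hb.isCountablyGenerated

/-- Given an expansion U, colour α by some n with α outside U n. If this colour is constantly g(δ)
on the ladder of δ, that ladder misses U (g δ), an open set containing the top of δ. -/
theorem not_countablyMetacompact_space (g : S → ℕ)
    (hg : ∀ f : Iio κ.ord → ℕ, ∃ δ, ∀ k, f (c δ k) = g δ) : ¬ CountablyMetacompact L.Space := by
  classical
  intro hCM
  obtain ⟨U, -, hU, hUe, hDU⟩ := hCM (fun n => {x | ∃ δ, x = L.top δ ∧ n ≤ g δ})
    (fun m n hmn x ⟨δ, hx, hδ⟩ => ⟨δ, hx, hmn.trans hδ⟩)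
    (fun n => by
      rw [← isOpen_compl_iff]
      intro δ hδ
      refine ⟨_, IsEndSegment.refl _, ?_⟩
      rintro α - ⟨ε, h, -⟩
      exact Sum.inl_ne_inr h)
    (by
      refine eq_empty_iff_forall_notMem.2 fun x hx => ?_
      obtain ⟨δ, rfl, -⟩ := mem_iInter.1 hx 0
      obtain ⟨ε, h, hε⟩ := mem_iInter.1 hx (g δ + 1)
      obtain rfl : δ = ε := Sum.inr_injective h
      omega)
  have hex : ∀ α, ∃ n, L.base α ∉ U n := fun α => by
    by_contra! h
    exact notMem_empty _ (hUe ▸ mem_iInter.2 h)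
  choose f hf using hex
  obtain ⟨δ, hδ⟩ := hg f
  obtain ⟨k, hk⟩ := exists_basic_subset hc hL (hU (g δ)) (hDU _ ⟨δ, rfl, le_rfl⟩)
  refine hf (c δ k) ?_
  rw [hδ]
  exact hk (base_mem_basic.2 ⟨k, self_mem_Ici, rfl⟩)

end

end LadderSystem

/-! ### Cardinal arithmetic -/

theorem nonempty_Iio_embedding {N : Type u} (δ : Iio (Order.succ #N).ord) :
    Nonempty (Iio δ ↪ N) := by
  have h1 : Nonempty (Iio δ ↪ Iio (δ : Ordinal.{u})) :=
    ⟨⟨fun x => ⟨x.1.1, x.2⟩, fun x y h => Subtype.ext (Subtype.ext (Subtype.mk.inj h))⟩⟩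
  obtain ⟨e⟩ := h1
  have h2 : Nonempty (Iio (δ : Ordinal.{u}) ↪ N) := by
    rw [← Cardinal.lift_mk_le', Cardinal.mk_Iio_ordinal]
    simp only [Cardinal.lift_lift, Cardinal.lift_le]
    have := lt_ord.1 δ.2
    simpa using Order.lt_succ_iff.1 this
  exact ⟨e.trans h2.some⟩

theorem exists_forall_lt_of_succ {N : Type u} [Infinite N] (q : N → Iio (Order.succ #N).ord) :
    ∃ y, ∀ x, q x < y := by
  have h : ⨆ x, ((q x : Ordinal.{u}) + 1) < (Order.succ #N).ord := by
    refine iSup_add_one_lt_of_lt_cof ?_ fun x => (q x).2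
    rw [(isRegular_succ (aleph0_le_mk N)).cof_ord]
    exact Order.lt_succ _
  exact ⟨⟨_, h⟩, fun x => show (q x : Ordinal.{u}) < _ from
    (Order.lt_succ _).trans_le (Ordinal.le_iSup (fun x => (q x : Ordinal.{u}) + 1) x)⟩

theorem mk_Iio_ord (κ : Cardinal.{u}) : #(Iio κ.ord) = Cardinal.lift.{u + 1} κ := by
  rw [Cardinal.mk_Iio_ordinal, card_ord]

/-- The Hausdorff formula. -/
theorem succ_power_le {μ θ : Cardinal.{u}} (hμ : ℵ₀ ≤ μ) (hθ : θ ≤ μ) :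
    Order.succ μ ^ θ ≤ Order.succ μ * μ ^ θ := by
  induction μ using Cardinal.inductionOn with | _ N
  induction θ using Cardinal.inductionOn with | _ Θ
  have : Infinite N := infinite_iff.2 hμ
  obtain ⟨j⟩ := hθ
  let Y := Iio (Order.succ #N).ord
  have hb : ∀ f : Θ → Y, ∃ y, ∀ t, f t < y := by
    intro f
    by_cases hΘ : Nonempty Θ
    · obtain ⟨y, hy⟩ := exists_forall_lt_of_succ fun x => f (Function.invFun j x)
      refine ⟨y, fun t => ?_⟩
      have := hy (j t)
      rwa [Function.leftInverse_invFun j.injective] at this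
    · exact ⟨⟨0, mem_Iio.2 (by simp [Cardinal.ord_pos])⟩, fun t => absurd ⟨t⟩ hΘ⟩
  choose y hy using hb
  have e : ∀ y : Y, Iio y ↪ N := fun y => (nonempty_Iio_embedding y).some
  -- Since f is bounded by `y f`, it is recovered from this bound and its image in N.
  have hinj : Function.Injective fun f : Θ → Y => (y f, fun t => e (y f) ⟨f t, hy f t⟩) := by
    intro f g h
    obtain ⟨h1, h2⟩ := Prod.mk.inj h
    funext t
    have h3 := congrFun h2 t
    have key : ∀ (z w : Y) (hz : f t < z) (hw : g t < w), z = w →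
        e z ⟨f t, hz⟩ = e w ⟨g t, hw⟩ → f t = g t := by
      rintro z _ hz hw rfl h
      exact congrArg Subtype.val ((e z).injective h)
    exact key _ _ _ _ h1 h3
  have := mk_le_of_injective hinj
  rw [← Cardinal.lift_le.{u + 1}]
  simpa [Y, mk_Iio_ord] using this

/-- Starting from χ, the Hausdorff formula carries the bound up through the finitely many
successors. -/
theorem iterate_succ_power_le {lam θ χ : Cardinal.{u}} (hlam : ℵ₀ ≤ lam) (hlt : lam < χ)
    (hθ : θ ≤ χ) (hχ : χ ^ θ ≤ χ) (n : ℕ) (hn : χ ≤ Order.succ^[n] lam) :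
    (Order.succ^[n] lam) ^ θ ≤ Order.succ^[n] lam := by
  induction n with
  | zero => exact absurd hn hlt.not_ge
  | succ n ih =>
    rw [Function.iterate_succ_apply'] at hn ⊢
    rcases hn.lt_or_eq with h | h
    · have h := Order.lt_succ_iff.1 h
      have h0 : ℵ₀ ≤ Order.succ^[n] lam := hlam.trans (hlt.le.trans h)
      refine (succ_power_le h0 (hθ.trans h)).trans
        ((mul_le_mul_right (ih h) _).trans ?_)
      exact (mul_eq_left (h0.trans (Order.le_succ _)) (Order.le_succ _)
        (aleph0_pos.trans_le h0).ne').le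
    · rw [← h]
      exact hχ

/-! ### Assembling the theorem -/

theorem exists_ladderSystem_of_guessing {ν : Cardinal.{u}} (hν : ℵ₀ ≤ ν)
    {c : Iio (Order.succ ν).ord → ℕ → Iio (Order.succ ν).ord} {g : Iio (Order.succ ν).ord → ℕ}
    (hc : ∀ δ, (∃ c, IsLadderSeq δ c) → IsLadderSeq δ (c δ))
    (hg : ∀ f : Iio (Order.succ ν).ord → ℕ, ∃ δ, (∃ c, IsLadderSeq δ c) ∧ ∀ k, f (c δ k) = g δ) :
    ∃ L : LadderSystem (Order.succ ν) (cofSet (Order.succ ν) ℵ₀), L.IsBounded ω ∧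
      RegularSpace L.Space ∧ T2Space L.Space ∧ FirstCountableTopology L.Space ∧
      ¬ CountablyMetacompact L.Space := by
  have hc' : ∀ δ : cofSet (Order.succ ν) ℵ₀, IsLadderSeq (δ : Iio (Order.succ ν).ord) (c δ) :=
    fun δ => hc _ (exists_isLadderSeq_of_cof_eq_aleph0 δ.2)
  obtain ⟨N, rfl⟩ : ∃ N : Type u, #N = ν := ⟨_, mk_out ν⟩
  have : Infinite N := infinite_iff.2 hν
  have : Nonempty (Iio (Order.succ #N).ord) := ⟨⟨0, by simp [Cardinal.ord_pos]⟩⟩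
  let L : LadderSystem (Order.succ #N) (cofSet (Order.succ #N) ℵ₀) :=
    { regular := isRegular_succ hν
      uncountable := hν.trans_lt (Order.lt_succ _)
      stationary := by
        refine isStationary_of_forall_isLadderSeq (fun q => ?_) fun δ c h => h.cof_eq_aleph0
        obtain ⟨y, hy⟩ := exists_forall_lt_of_succ
          fun x => q (Function.invFun (Infinite.natEmbedding N) x)
        refine ⟨y, fun n => ?_⟩
        have := hy (Infinite.natEmbedding N n)
        rwa [Function.leftInverse_invFun (Infinite.natEmbedding N).injective] at this
      ladder := fun δ => range (c δ)
      lt_of_mem := by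
        rintro δ _ ⟨k, rfl⟩
        exact (hc' δ).lt k
      cofinal := fun δ β hβ => by
        obtain ⟨k, hk⟩ := (hc' δ).exists_lt hβ
        exact ⟨_, ⟨k, rfl⟩, hk.le⟩ }
  have hL : ∀ δ, L.ladder δ = range (c δ) := fun _ => rfl
  refine ⟨L, fun δ => type_range_le_omega0 (hc' δ).1, L.regularSpace_space hc' hL,
    L.t2Space_space hc' hL, L.firstCountableTopology_space hc' hL,
    L.not_countablyMetacompact_space hc' hL (fun δ => g δ) fun f => ?_⟩
  obtain ⟨δ, ⟨d, hd⟩, hδ⟩ := hg f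
  exact ⟨⟨δ, hd.cof_eq_aleph0⟩, hδ⟩

theorem exists_guessing_of_power {χ ν : Cardinal.{u}} (hχ : ℵ₀ ≤ χ) (hχν : χ ≤ ν)
    (hκ : Order.succ ν = 2 ^ χ) (hχc : χ ^ 𝔠 ≤ χ) (hνc : ν ^ 𝔠 ≤ ν) :
    ∃ (c : Iio (Order.succ ν).ord → ℕ → Iio (Order.succ ν).ord) (g : Iio (Order.succ ν).ord → ℕ),
      (∀ δ, (∃ c, IsLadderSeq δ c) → IsLadderSeq δ (c δ)) ∧
      ∀ f : Iio (Order.succ ν).ord → ℕ, ∃ δ, (∃ c, IsLadderSeq δ c) ∧ ∀ k, f (c δ k) = g δ := by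
  obtain ⟨X, rfl⟩ : ∃ X : Type u, #X = χ := ⟨_, mk_out χ⟩
  obtain ⟨N, rfl⟩ : ∃ N : Type u, #N = ν := ⟨_, mk_out ν⟩
  have : Infinite X := infinite_iff.2 hχ
  have : Infinite N := infinite_iff.2 (hχ.trans hχν)
  have : Nonempty (Iio (Order.succ #N).ord) := ⟨⟨0, by simp [Cardinal.ord_pos]⟩⟩
  have hω : #(ℕ → ℕ) = 𝔠 := by simp
  have hW : #(ω_ 1).ToType = ℵ₁ := by simp
  have : Uncountable (ω_ 1).ToType := by
    rw [← aleph0_lt_mk_iff, hW]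
    exact aleph0_lt_aleph_one
  refine exists_guessing_ladders (X := X) (N := N) (W := (ω_ 1).ToType) (fun i => ?_) ?_ ?_ ?_ ?_
    ?_ ?_ nonempty_Iio_embedding exists_forall_lt_of_succ
  · rw [← le_aleph0_iff_set_countable, ← Order.lt_succ_iff, succ_aleph0, ← hW]
    exact mk_Iio_lt i (by rw [hW]; simp)
  · rw [← Cardinal.eq, mk_prod, hω]
    simp only [Cardinal.lift_id, hW]
    exact (mul_eq_right aleph0_le_continuum aleph_one_le_continuum (aleph_pos 1).ne').symm
  · rw [← Cardinal.lift_mk_le']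
    simpa using hχc
  · rw [← Cardinal.lift_mk_le']
    simpa using hνc
  · rw [← Cardinal.lift_mk_le', mk_Iio_ord, hκ]
    simp
  · rw [← Cardinal.lift_mk_le', mk_Iio_ord, hκ]
    simp [power_eq_two_power, hχ]
  · rw [← Cardinal.lift_mk_le', mk_Iio_ord]
    simpa using cantor (Cardinal.lift.{u + 1} #N)

theorem exists_ladderSystem_not_countablyMetacompact {lam κ : Cardinal.{u}} (hlam : ℵ₀ ≤ lam)
    (hκ : κ = 2 ^ ((2 : Cardinal.{u}) ^ ((2 : Cardinal.{u}) ^ lam)))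
    (hn : ∃ n : ℕ, κ = Order.succ^[n] lam) :
    ∃ L : LadderSystem κ (cofSet κ ℵ₀), L.IsBounded ω ∧
      RegularSpace L.Space ∧ T2Space L.Space ∧ FirstCountableTopology L.Space ∧
      ¬ CountablyMetacompact L.Space := by
  obtain ⟨n, hn⟩ := hn
  have h1 : lam < 2 ^ lam := cantor _
  have h2 : (2 : Cardinal) ^ lam < 2 ^ ((2 : Cardinal.{u}) ^ lam) := cantor _
  have h3 : (2 : Cardinal) ^ ((2 : Cardinal.{u}) ^ lam) < κ := hκ ▸ cantor _
  -- Since λ < κ, at least one successor is taken; κ = ν⁺ is therefore regular.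
  obtain _ | n := n
  · exact absurd (h1.trans (h2.trans h3)) (by simp [hn])
  rw [Function.iterate_succ_apply'] at hn
  rw [hn] at h3 hκ
  have h4 := Order.lt_succ_iff.1 h3
  have h5 : (2 : Cardinal) ^ ((2 : Cardinal.{u}) ^ lam) ≠ 0 := (bot_le.trans_lt h2).ne'
  have hχ : ((2 : Cardinal) ^ ((2 : Cardinal.{u}) ^ lam)) ^ ((2 : Cardinal.{u}) ^ lam) ≤
      2 ^ ((2 : Cardinal.{u}) ^ lam) := by
    rw [← power_mul, mul_eq_self (hlam.trans h1.le)]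
  have hc : 𝔠 ≤ (2 : Cardinal.{u}) ^ lam := by
    rw [← two_power_aleph0]
    exact power_le_power_left two_ne_zero hlam
  have hν := iterate_succ_power_le hlam (h1.trans h2) h2.le hχ n h4
  obtain ⟨c, g, hcd, hg⟩ := exists_guessing_of_power (hlam.trans (h1.trans h2).le) h4 hκ
    ((power_le_power_left h5 hc).trans hχ)
    ((power_le_power_left ((bot_le.trans_lt h2).trans_le h4).ne' hc).trans hν)
  subst hn
  exact exists_ladderSystem_of_guessing ((hlam.trans (h1.trans h2).le).trans h4) hcd hg

theorem exists_eq_iterate_succ_aleph0 {κ : Cardinal.{u}} (h0 : ℵ₀ ≤ κ) (h : κ < ℵ_ ω) :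
    ∃ n : ℕ, κ = Order.succ^[n] ℵ₀ := by
  obtain ⟨o, rfl⟩ := mem_range_aleph_iff.2 h0
  obtain ⟨n, rfl⟩ := lt_omega0.1 (aleph_lt_aleph.1 h)
  refine ⟨n, ?_⟩
  induction n with
  | zero => simp
  | succ n ih =>
    rw [Function.iterate_succ_apply', ← ih (by simp) (by simp), Nat.cast_add, Nat.cast_one,
      succ_aleph]

theorem theoremB :
    (∀ lam κ : Cardinal.{u}, ℵ₀ ≤ lam → κ = 2 ^ ((2 : Cardinal.{u}) ^ ((2 : Cardinal.{u}) ^ lam)) →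
      (∃ n : ℕ, κ = Order.succ^[n] lam) →
      ∃ L : LadderSystem κ (cofSet κ ℵ₀), L.IsBounded ω ∧
        RegularSpace L.Space ∧ T2Space L.Space ∧ FirstCountableTopology L.Space ∧
        ¬ CountablyMetacompact L.Space) ∧
    (∀ κ : Cardinal.{u}, κ = 2 ^ ((2 : Cardinal.{u}) ^ ((2 : Cardinal.{u}) ^ (ℵ₀ : Cardinal.{u}))) →
      κ < ℵ_ ω →
      ∃ L : LadderSystem κ (cofSet κ ℵ₀), L.IsBounded ω ∧
        RegularSpace L.Space ∧ T2Space L.Space ∧ FirstCountableTopology L.Space ∧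
        ¬ CountablyMetacompact L.Space) := by
  refine ⟨fun lam κ hlam hκ hn => exists_ladderSystem_not_countablyMetacompact hlam hκ hn,
    fun κ hκ h => exists_ladderSystem_not_countablyMetacompact le_rfl hκ
      (exists_eq_iterate_succ_aleph0 ?_ h)⟩
  rw [hκ]
  exact ((cantor _).trans ((cantor _).trans (cantor _))).le
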